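/- Let $F$ be a finite field with $q$ elements, $G=GL(2,F)$, and let $A=C(G)$ be the $*$-algebra of complex functions on $G$ with the coproduct $\Phi(f)(x,y)=f(xy)$. Let $T\le G$ be the subgroup of diagonal matrices and $K=(\mathbb Z/(q-1)\mathbb Z)^2$, with pairing $\langle s,t\rangle=e^{2\pi i(s_1t_1+s_2t_2)/(q-1)}$ and standard skew-symmetric automorphism $S=\begin{pmatrix}0&1\\-1&0\end{pmatrix}$, i.e. $S(s_1,s_2)=(s_2,-s_1)$. Then $T$ is isomorphic to $K$. Identify $T$ with $K$ by any group isomorphism. For $s,u\in T$ put $(\alpha_{(s,u)}f)(x)=f(s^{-1}xu)$, let $H=T\oplus T$, $J=S\oplus(-S)$, with the pairing on $H$ being the product of those on the two summands, and define the deformed product on $A$ by $$a\times_J b=\frac1{|H|}\sum_{h,k\in H}\langle Jh,k\rangle\,\alpha_h(a)\,\alpha_k(b).$$ Write $C(G)_J$ for the vector space $A$ with the product $\times_J$ and the original involution and coproduct $\Phi$. Then: 1. $C(G)_J$ is a finite quantum group, i.e. a finite-dimensional unital $C^*$-algebra (for a suitable norm) which is a Hopf algebra whose coproduct is a $*$-homomorphism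 (and whose coinverse is involutive and commutes with $*$). It contains $T$ as a subgroup: the restriction map $C(G)_J\to C(T)$ is a surjective $*$-homomorphism intertwining the coproducts, where $C(T)$ carries the ordinary pointwise product. 2. If $q\ne 2,3$, then $C(G)_J$ is noncommutative ($a\times_J b\ne b\times_J a$ for some $a,b$) and noncocommutative ($\Phi$ is not invariant under the flip of $A\otimes A$). -/

import Mathlib

open scoped TensorProduct

noncomputable section

universe u

/-! ## Finite quantum groups -/

/-- A finite quantum group, given by its function algebra `B`: a finite dimensional unital
`C*`-algebra which is a Hopf algebra whose coproduct is a `*`-homomorphism.  (Multiplicativity and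
unitality of the coproduct and the counit, coassociativity and the antipode identities are part of
`HopfAlgebra`.)  The coinverse is moreover asked to be an involution commuting with `*`. -/
class FiniteQuantumGroup (B : Type u) extends CStarAlgebra B, HopfAlgebra ℂ B where
  finiteDimensional : FiniteDimensional ℂ B
  comul_star : ∀ b : B, comul (star b) = Star.star (comul b)
  counit_star : ∀ b : B, counit (star b) = Star.star (counit b)
  antipode_star : ∀ b : B, antipode (star b) = star (antipode b)
  antipode_antipode : ∀ b : B, antipode (antipode b) = b

/-- The complex vector space `V` with the product `mul`, the involution `st` and the coproduct `Φ`
is a finite quantum group.  (The unit, the `C*`-norm, the counit and the coinverse are uniquely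
determined by these data.) -/
def IsFiniteQuantumGroup {V : Type u} [AddCommGroup V] [Module ℂ V]
    (mul : V → V → V) (st : V → V) (Φ : V →ₗ[ℂ] V ⊗[ℂ] V) : Prop :=
  ∃ (B : Type u) (_ : FiniteQuantumGroup B) (φ : V ≃ₗ[ℂ] B),
    (∀ a b : V, φ (mul a b) = φ a * φ b) ∧
    (∀ a : V, φ (st a) = star (φ a)) ∧
    (∀ a : V, Coalgebra.comul (R := ℂ) (φ a) =
      TensorProduct.map φ.toLinearMap φ.toLinearMap (Φ a))

/-! ## The function algebra of a finite group -/

/-- The coproduct `Φ` of `C(G) = (G → ℂ)`: under `C(G) ⊗ C(G) = C(G × G)` the element `Φ f`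
is the function `(x, y) ↦ f (x * y)`; here `Pi.single x 1` is the indicator function of `x`. -/
def functionCoproduct (G : Type u) [Group G] [Fintype G] [DecidableEq G] :
    (G → ℂ) →ₗ[ℂ] (G → ℂ) ⊗[ℂ] (G → ℂ) :=
  ∑ x : G, ∑ y : G, (LinearMap.proj (R := ℂ) (φ := fun _ : G => ℂ) (x * y)).smulRight
    ((Pi.single x (1 : ℂ) : G → ℂ) ⊗ₜ[ℂ] (Pi.single y (1 : ℂ) : G → ℂ))

/-- The restriction map `π : C(G) → C(T)` for a subgroup `T` of `G`. -/
def restrictToSubgroup {G : Type u} [Group G] (T : Subgroup G) : (G → ℂ) →ₗ[ℂ] (T → ℂ) :=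
  LinearMap.funLeft ℂ ℂ (Subtype.val : T → G)

/-- The action `α_(s,u) = λ_s ρ_u` of `K ⊕ K` on `C(G)`, for an (additively written) abelian group
`K` and a homomorphism `ι : K → G`, where `(λ_s f)(x) = f (ι(s)⁻¹ x)` and
`(ρ_u f)(x) = f (x ι(u))`. -/
def translationAction {G : Type u} [Group G] {K : Type*} [AddCommGroup K]
    (ι : Multiplicative K →* G) (h : K × K) (f : G → ℂ) : G → ℂ :=
  fun x => f ((ι (Multiplicative.ofAdd h.1))⁻¹ * x * ι (Multiplicative.ofAdd h.2))

/-! ## The deformed product -/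

/-- The deformed product
`a ×_J b = |H| ∫_{s,t ∈ H} α_s(a) α_t(b) ⟨J s, t⟩`
on an algebra `A` with an action `α` of a finite abelian group `H` with pairing `⟨·,·⟩`,
where `∫_{s,t ∈ H}` is the normalized sum `|H|⁻² ∑_{s,t ∈ H}`. -/
def deformedMul {A : Type*} [Ring A] [Algebra ℂ A] {H : Type*} [AddCommGroup H] [Fintype H]
    (α : H → A → A) (pairing : H → H → ℂ) (J : H ≃+ H) (a b : A) : A :=
  (Fintype.card H : ℂ) • (((Fintype.card H : ℂ) ^ 2)⁻¹ •
    ∑ s : H, ∑ t : H, pairing (J s) t • (α s a * α t b))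

/-- The Pontryagin pairing `⟨s, t⟩ = e^{2 π i (s₁ t₁ / n + s₂ t₂ / n)}` on `(ℤ/n)²`. -/
def zmodPairing (n : ℕ) [NeZero n] (s t : ZMod n × ZMod n) : ℂ :=
  ZMod.stdAddChar (s.1 * t.1) * ZMod.stdAddChar (s.2 * t.2)

/-- The automorphism of `(ℤ/n)²` with matrix `(0 1; -1 0)`. -/
def standardSkew (n : ℕ) : (ZMod n × ZMod n) ≃+ (ZMod n × ZMod n) where
  toFun s := (s.2, -s.1)
  invFun s := (-s.2, s.1)
  left_inv s := by simp
  right_inv s := by simp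
  map_add' s t := by ext <;> simp [add_comm]

/-- The pairing induced on the direct sum `K ⊕ K` by a pairing on `K`. -/
def sumPairing {K : Type*} (pairing : K → K → ℂ) (h k : K × K) : ℂ :=
  pairing h.1 k.1 * pairing h.2 k.2

/-- The automorphism `J = S ⊕ (-S)` of `K ⊕ K`. -/
def skewDouble {K : Type*} [AddCommGroup K] (S : K ≃+ K) : (K × K) ≃+ (K × K) :=
  S.prodCongr (S.trans (AddEquiv.neg K))

/-- The product of `C(G)_J`, where `T` is a subgroup of `G` identified with `(ℤ/n)²` by `e`,
and `J = S ⊕ (-S)` for the standard skew-symmetric automorphism `S` of `(ℤ/n)²`. -/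
def torusDeformedMul {G : Type u} [Group G] {n : ℕ} [NeZero n] (T : Subgroup G)
    (e : Multiplicative (ZMod n × ZMod n) ≃* T) : (G → ℂ) → (G → ℂ) → (G → ℂ) :=
  deformedMul (translationAction (T.subtype.comp e.toMonoidHom)) (sumPairing (zmodPairing n))
    (skewDouble (standardSkew n))

/-! ## The diagonal torus of `GL(2, F)` -/

/-- The subgroup of diagonal matrices in `GL(2, F)`. -/
def diagonalTorus (F : Type u) [Field F] : Subgroup (GL (Fin 2) F) :=
  (Units.map ((Matrix.diagonalRingHom (Fin 2) F : (Fin 2 → F) →+* Matrix (Fin 2) (Fin 2) F) :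
    (Fin 2 → F) →* Matrix (Fin 2) (Fin 2) F)).range

instance neZero_card_sub_one (F : Type u) [Field F] [Fintype F] :
    NeZero (Fintype.card F - 1) :=
  ⟨Nat.sub_ne_zero_of_lt Fintype.one_lt_card⟩

end

/-! Put ω(s,t) = ⟨Ss,t⟩ on K. It is an alternating nondegenerate unitary bicharacter, and J = S ⊕
(-S) gives ω ⊕ ω⁻¹ on K ⊕ K. After `torusDeformedMul_eq` only these properties of ω are used, and
nearly every identity is a shift of summation variables followed by character orthogonality.

Unit, associativity (`sum_assoc`) and compatibility with the involution need only one such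
bicharacter on the group that acts. The opposite signs on the two summands matter for the Hopf
structure: in a product of translates of x and y, the right leg of x meets the left leg of y, their
phases are mutually inverse, and `sum_collapse` removes both. So the old coproduct stays
multiplicative (`twistedMul_comul_sum`). The same lemma makes the product pointwise on T, hence
evaluation at 1 is still a counit; inversion of the argument is still a coinverse.

For the C*-norm, summation over G takes the same value on a twisted and on a pointwise product
(`sum_twistedMul`). So left multiplication is a faithful *-representation on ℓ²(G), and the operator
norm is pulled back.

For noncommutativity, take x = (1 1; 0 1). Its stabilizer under two-sided translation is the
diagonal copy of the scalar matrices, a cyclic group of order q - 1. Two indicator functions on the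
orbit of x then multiply at x with phases ω(z,v) and ω(v,z), where z is the scalar generator; these
differ for some v once 2z ≠ 0, that is, once q - 1 > 2. Noncocommutativity is just that GL(2,F) is
not abelian. -/

/-- An alternating nondegenerate unitary bicharacter on a finite abelian group. -/
structure IsSymplecticBicharacter {H : Type*} [AddCommGroup H] [Fintype H] (ω : H → H → ℂ) :
    Prop where
  add_left : ∀ a b c, ω (a + b) c = ω a c * ω b c
  add_right : ∀ a b c, ω a (b + c) = ω a b * ω a c
  self : ∀ a, ω a a = 1
  star : ∀ a b, Star.star (ω a b) = ω b a
  sum_right : ∀ a, a ≠ 0 → ∑ b, ω a b = 0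

/-! ### Character sums for an alternating bicharacter -/

namespace IsSymplecticBicharacter

variable {H : Type*} [AddCommGroup H] [Fintype H] {ω : H → H → ℂ}

section basic
variable (hω : IsSymplecticBicharacter ω)
include hω

/-- Polarization: expand ω(a+b, a+b) = 1. -/
theorem swap_mul (a b : H) : ω a b * ω b a = 1 := by
  have h := hω.self (a + b)
  rwa [hω.add_left, hω.add_right, hω.add_right, hω.self, hω.self, one_mul, mul_one] at h

theorem zero_right (a : H) : ω a 0 = 1 := by
  have h := hω.add_right a 0 0
  have h' := hω.swap_mul a 0
  rw [add_zero] at h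
  have h0 : ω a 0 ≠ 0 := left_ne_zero_of_mul_eq_one h'
  exact mul_left_cancel₀ h0 (by rw [← h, mul_one])

theorem zero_left (a : H) : ω 0 a = 1 := by
  simpa [hω.zero_right] using hω.swap_mul 0 a

theorem neg_right (a b : H) : ω a (-b) = ω b a := by
  have h := hω.add_right a b (-b)
  rw [add_neg_cancel, hω.zero_right] at h
  have h' := hω.swap_mul a b
  exact mul_left_cancel₀ (left_ne_zero_of_mul_eq_one h') (by rw [← h, h'])

theorem neg_left (a b : H) : ω (-a) b = ω b a := by
  have h := hω.add_left a (-a) b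
  rw [add_neg_cancel, hω.zero_left] at h
  have h' := hω.swap_mul a b
  exact mul_left_cancel₀ (left_ne_zero_of_mul_eq_one h') (by rw [← h, h'])

theorem sum_right_eq [DecidableEq H] (a : H) :
    ∑ b, ω a b = if a = 0 then (Fintype.card H : ℂ) else 0 := by
  split_ifs with h
  · simp [h, hω.zero_left]
  · exact hω.sum_right a h

theorem sum_left_eq [DecidableEq H] (b : H) :
    ∑ a, ω a b = if b = 0 then (Fintype.card H : ℂ) else 0 := by
  rw [← hω.sum_right_eq, ← Equiv.sum_comp (Equiv.neg H)]
  simp [hω.neg_left]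

/-- The bicharacter `ω ⊕ ω⁻¹` on `H ⊕ H`. -/
theorem double :
    IsSymplecticBicharacter (fun h k : H × H => ω h.1 k.1 * ω k.2 h.2) where
  add_left a b c := by simp only [Prod.fst_add, Prod.snd_add, hω.add_left, hω.add_right]; ring
  add_right a b c := by simp only [Prod.fst_add, Prod.snd_add, hω.add_left, hω.add_right]; ring
  self a := by simp [hω.self]
  star a b := by simp only [star_mul', hω.star]
  sum_right a ha := by
    classical
    rw [Fintype.sum_prod_type]
    simp only [← Finset.mul_sum, ← Finset.sum_mul, hω.sum_right_eq, hω.sum_left_eq]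
    by_cases h1 : a.1 = 0
    · have h2 : a.2 ≠ 0 := fun h2 => ha (Prod.ext h1 h2)
      simp [h2]
    · simp [h1]

theorem sum_sum_left (f : H → ℂ) :
    ∑ h, ∑ k, ω h k * f h = Fintype.card H * f 0 := by
  classical
  simp [← Finset.sum_mul, hω.sum_right_eq]

theorem sum_sum_right (f : H → ℂ) :
    ∑ h, ∑ k, ω h k * f k = Fintype.card H * f 0 := by
  classical
  rw [Finset.sum_comm]
  simp [← Finset.sum_mul, hω.sum_left_eq]

theorem sum_sum_sub (f : H → ℂ) :
    ∑ h, ∑ k, ω h k * f (h - k) = Fintype.card H * f 0 := by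
  rw [← hω.sum_sum_left, Finset.sum_comm]
  conv_rhs => rw [Finset.sum_comm]
  refine Finset.sum_congr rfl fun k _ => ?_
  rw [← Equiv.sum_comp (Equiv.addRight k)]
  simp [hω.add_left, hω.self]

/-- Two inverse twists cancel. This one identity carries both the multiplicativity of the coproduct
and the triviality of the product on T. -/
theorem sum_collapse (P Q : H → ℂ) :
    ∑ a, ∑ b, ∑ c, ∑ d, ω c a * ω b d * (P (a - b) * Q (c - d)) =
      (Fintype.card H : ℂ) ^ 2 * (P 0 * Q 0) := by
  classical
  calc _ = ∑ b, ∑ d, ∑ a, ∑ c, ω c a * ω b d * (P (a - b) * Q (c - d)) := by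
        rw [Finset.sum_comm]
        refine Finset.sum_congr rfl fun b _ => ?_
        rw [Finset.sum_comm' (t' := Finset.univ) (s' := fun _ => Finset.univ) (by simp)]
        rw [Finset.sum_comm]
        conv_rhs => rw [Finset.sum_comm]
        refine Finset.sum_congr rfl fun c _ => ?_
        rw [Finset.sum_comm]
    -- Shift a by b and c by d. The factors ω(d,b) and ω(b,d) cancel, so b survives only in the
    -- character ω(c,b) = ω(b,-c), and summing over b forces c = 0.
    _ = ∑ b, ∑ d, ∑ a, ∑ c, ω b (- c) * (ω c a * ω d a * (P a * Q c)) := by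
        refine Finset.sum_congr rfl fun b _ => Finset.sum_congr rfl fun d _ => ?_
        rw [← Equiv.sum_comp (Equiv.addRight b)]
        refine Finset.sum_congr rfl fun a _ => ?_
        rw [← Equiv.sum_comp (Equiv.addRight d)]
        refine Finset.sum_congr rfl fun c _ => ?_
        have h := hω.swap_mul b d
        simp only [Equiv.coe_addRight, add_sub_cancel_right, hω.add_left, hω.add_right,
          hω.neg_right]
        linear_combination (ω c a * ω c b * ω d a * (P a * Q c)) * h
    _ = ∑ d, ∑ a, ∑ c, (if c = 0 then (Fintype.card H : ℂ) else 0) *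
          (ω c a * ω d a * (P a * Q c)) := by
        rw [Finset.sum_comm]
        refine Finset.sum_congr rfl fun d _ => ?_
        rw [Finset.sum_comm]
        refine Finset.sum_congr rfl fun a _ => ?_
        rw [Finset.sum_comm]
        refine Finset.sum_congr rfl fun c _ => ?_
        rw [← Finset.sum_mul, hω.sum_left_eq]
        simp
    _ = ∑ d, ∑ a, ω d a * (Fintype.card H * (P a * Q 0)) := by
        refine Finset.sum_congr rfl fun d _ => Finset.sum_congr rfl fun a _ => ?_
        simp [hω.zero_left]; ring
    _ = _ := by
        rw [hω.sum_sum_right]; ring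

/-- Associativity of the deformed product, with A, B, C the values along an orbit. Undoing the shift
in the inner sum leaves a variable that occurs only in a character; summing it out reduces both
sides to |H| times the sum of ω(h,k') A(h) B(h+k') C(k'). -/
theorem sum_assoc (A B C : H → ℂ) :
    ∑ h', ∑ k', ω h' k' * ((∑ h, ∑ k, ω h k * (A (h + h') * B (k + h'))) * C k') =
      ∑ h, ∑ k, ω h k * (A h * ∑ h', ∑ k', ω h' k' * (B (h' + k) * C (k' + k))) := by
  classical
  have hL : ∀ h', ∑ h, ∑ k, ω h k * (A (h + h') * B (k + h')) =
      ∑ h, ∑ k, ω h k * ω h' (h - k) * (A h * B k) := by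
    intro h'
    rw [← Equiv.sum_comp (Equiv.subRight h')]
    refine Finset.sum_congr rfl fun h _ => ?_
    rw [← Equiv.sum_comp (Equiv.subRight h')]
    refine Finset.sum_congr rfl fun k _ => ?_
    simp only [Equiv.subRight_apply, sub_add_cancel]
    simp only [sub_eq_add_neg, hω.add_left, hω.add_right, hω.neg_right, hω.neg_left, hω.self]
    ring
  have hR : ∀ k, ∑ h', ∑ k', ω h' k' * (B (h' + k) * C (k' + k)) =
      ∑ h', ∑ k', ω h' k' * ω k (h' - k') * (B h' * C k') := by
    intro k
    rw [← Equiv.sum_comp (Equiv.subRight k)]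
    refine Finset.sum_congr rfl fun h _ => ?_
    rw [← Equiv.sum_comp (Equiv.subRight k)]
    refine Finset.sum_congr rfl fun k' _ => ?_
    simp only [Equiv.subRight_apply, sub_add_cancel]
    simp only [sub_eq_add_neg, hω.add_left, hω.add_right, hω.neg_right, hω.neg_left, hω.self]
    ring
  simp only [hL, hR]
  have e1 : ∀ h k k', ∑ h', ω h' k' * (ω h k * ω h' (h - k) * (A h * B k) * C k') =
      (if k' + (h - k) = 0 then (Fintype.card H : ℂ) else 0) * (ω h k * (A h * B k * C k')) := by
    intro h k k'
    rw [← hω.sum_left_eq, Finset.sum_mul]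
    refine Finset.sum_congr rfl fun h' _ => ?_
    rw [hω.add_right]; ring
  have e2 : ∀ h h' k', ∑ k, ω h k * (A h * (ω h' k' * ω k (h' - k') * (B h' * C k'))) =
      (if h' - k' - h = 0 then (Fintype.card H : ℂ) else 0) *
        (ω h' k' * (A h * B h' * C k')) := by
    intro h h' k'
    rw [← hω.sum_left_eq, Finset.sum_mul]
    refine Finset.sum_congr rfl fun k _ => ?_
    rw [sub_eq_add_neg (h' - k'), hω.add_right, hω.neg_right]; ring
  calc _ = ∑ h, ∑ k, ∑ k', ∑ h', ω h' k' * (ω h k * ω h' (h - k) * (A h * B k) * C k') := by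
        simp only [Finset.mul_sum, Finset.sum_mul]
        rw [Finset.sum_comm]
        rw [Finset.sum_congr rfl fun k' _ => Finset.sum_comm]
        rw [Finset.sum_comm]
        refine Finset.sum_congr rfl fun h _ => ?_
        rw [Finset.sum_congr rfl fun k' _ => Finset.sum_comm]
        rw [Finset.sum_comm]
    -- The argument of B is called k on the left and h' on the right. Either way orthogonality pins
    -- it to h + k', and the leftover phases agree because ω is alternating.
    _ = ∑ h, ∑ h', ∑ k', ∑ k, ω h k * (A h * (ω h' k' * ω k (h' - k') * (B h' * C k'))) := by
        refine Finset.sum_congr rfl fun h _ => Finset.sum_congr rfl fun k _ =>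
          Finset.sum_congr rfl fun k' _ => ?_
        rw [e1, e2]
        by_cases hk : k = h + k'
        · subst hk
          simp [hω.add_left, hω.add_right, hω.self]
        · rw [if_neg, if_neg]
          · simp
          · intro h0; apply hk; rw [sub_sub, sub_eq_zero] at h0; rw [h0, add_comm]
          · intro h0; apply hk; rw [← add_sub_assoc, sub_eq_zero] at h0; rw [← h0, add_comm]
    _ = _ := by
        refine Finset.sum_congr rfl fun h _ => ?_
        simp only [Finset.mul_sum]
        conv_rhs => rw [Finset.sum_comm]
        refine Finset.sum_congr rfl fun h' _ => ?_
        rw [Finset.sum_comm]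

end basic
end IsSymplecticBicharacter

/-! ### Two-sided translation and the twisted product -/

/-- The bicharacter `ω ⊕ ω⁻¹` on `K ⊕ K`. -/
def doubleBicharacter {K : Type*} (ω : K → K → ℂ) (h k : K × K) : ℂ := ω h.1 k.1 * ω k.2 h.2

theorem IsSymplecticBicharacter.doubleBicharacter {K : Type*} [AddCommGroup K] [Fintype K]
    {ω : K → K → ℂ} (hω : IsSymplecticBicharacter ω) :
    IsSymplecticBicharacter (doubleBicharacter ω) :=
  hω.double

/-- The action `x ↦ ι(s)⁻¹ x ι(u)` of `K ⊕ K` on `G`. -/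
def twoSidedTranslate {G : Type*} [Group G] {K : Type*} [AddCommGroup K]
    (ι : Multiplicative K →* G) (h : K × K) (x : G) : G :=
  (ι (Multiplicative.ofAdd h.1))⁻¹ * x * ι (Multiplicative.ofAdd h.2)

section translate
variable {G : Type*} [Group G] {K : Type*} [AddCommGroup K] (ι : Multiplicative K →* G)

theorem twoSidedTranslate_add (h k : K × K) (x : G) :
    twoSidedTranslate ι (h + k) x = twoSidedTranslate ι h (twoSidedTranslate ι k x) := by
  have e : h.2 + k.2 = k.2 + h.2 := add_comm _ _
  simp only [twoSidedTranslate, Prod.fst_add, Prod.snd_add, e, add_comm h.1, ofAdd_add, map_mul,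
    mul_inv_rev]
  group

theorem twoSidedTranslate_zero (x : G) : twoSidedTranslate ι 0 x = x := by
  simp [twoSidedTranslate]

theorem twoSidedTranslate_neg (h : K × K) (x : G) :
    twoSidedTranslate ι (-h) (twoSidedTranslate ι h x) = x := by
  rw [← twoSidedTranslate_add, neg_add_cancel, twoSidedTranslate_zero]

theorem twoSidedTranslate_neg' (h : K × K) (x : G) :
    twoSidedTranslate ι h (twoSidedTranslate ι (-h) x) = x := by
  rw [← twoSidedTranslate_add, add_neg_cancel, twoSidedTranslate_zero]

theorem twoSidedTranslate_inv (h : K × K) (x : G) :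
    (twoSidedTranslate ι h x)⁻¹ = twoSidedTranslate ι h.swap x⁻¹ := by
  simp [twoSidedTranslate, mul_assoc]

/-- Translation as a permutation. -/
def twoSidedTranslateEquiv (h : K × K) : G ≃ G where
  toFun := twoSidedTranslate ι h
  invFun := twoSidedTranslate ι (-h)
  left_inv := twoSidedTranslate_neg ι h
  right_inv := twoSidedTranslate_neg' ι h

end translate

/-- The product of functions on `G` twisted by the bicharacter `ω` through `ι : K → G`. -/
noncomputable def twistedMul {G : Type*} [Group G] {K : Type*} [AddCommGroup K] [Fintype K]
    (ω : K → K → ℂ) (ι : Multiplicative K →* G) (a b : G → ℂ) : G → ℂ := fun x =>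
  (Fintype.card (K × K) : ℂ)⁻¹ * ∑ h : K × K, ∑ k : K × K, doubleBicharacter ω h k *
    (a (twoSidedTranslate ι h x) * b (twoSidedTranslate ι k x))

section twistedMul
variable {G : Type*} [Group G] {K : Type*} [AddCommGroup K] [Fintype K]
  {ω : K → K → ℂ} {ι : Multiplicative K →* G}

theorem twistedMul_add (a b c : G → ℂ) :
    twistedMul ω ι a (b + c) = twistedMul ω ι a b + twistedMul ω ι a c := by
  ext x
  simp [twistedMul, mul_add, Finset.sum_add_distrib]

theorem add_twistedMul (a b c : G → ℂ) :
    twistedMul ω ι (a + b) c = twistedMul ω ι a c + twistedMul ω ι b c := by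
  ext x
  simp [twistedMul, mul_add, add_mul, Finset.sum_add_distrib]

theorem smul_twistedMul (r : ℂ) (a b : G → ℂ) :
    twistedMul ω ι (r • a) b = r • twistedMul ω ι a b := by
  ext x
  simp only [twistedMul, Pi.smul_apply, smul_eq_mul, Finset.mul_sum]
  exact Finset.sum_congr rfl fun _ _ => Finset.sum_congr rfl fun _ _ => by ring

theorem twistedMul_smul (r : ℂ) (a b : G → ℂ) :
    twistedMul ω ι a (r • b) = r • twistedMul ω ι a b := by
  ext x
  simp only [twistedMul, Pi.smul_apply, smul_eq_mul, Finset.mul_sum]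
  exact Finset.sum_congr rfl fun _ _ => Finset.sum_congr rfl fun _ _ => by ring

section
variable (hω : IsSymplecticBicharacter ω)
include hω

theorem one_twistedMul (a : G → ℂ) : twistedMul ω ι 1 a = a := by
  ext x
  have := hω.doubleBicharacter.sum_sum_right fun k => a (twoSidedTranslate ι k x)
  simp only [twistedMul, Pi.one_apply, one_mul, this, twoSidedTranslate_zero]
  rw [inv_mul_cancel_left₀ (Nat.cast_ne_zero.2 Fintype.card_ne_zero)]

theorem twistedMul_one (a : G → ℂ) : twistedMul ω ι a 1 = a := by
  ext x
  have := hω.doubleBicharacter.sum_sum_left fun k => a (twoSidedTranslate ι k x)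
  simp only [twistedMul, Pi.one_apply, mul_one, this, twoSidedTranslate_zero]
  rw [inv_mul_cancel_left₀ (Nat.cast_ne_zero.2 Fintype.card_ne_zero)]

theorem twistedMul_assoc (a b c : G → ℂ) :
    twistedMul ω ι (twistedMul ω ι a b) c = twistedMul ω ι a (twistedMul ω ι b c) := by
  ext x
  have := hω.doubleBicharacter.sum_assoc (fun h => a (twoSidedTranslate ι h x))
    (fun h => b (twoSidedTranslate ι h x)) (fun h => c (twoSidedTranslate ι h x))
  simp only [twoSidedTranslate_add] at this
  simp only [twistedMul, mul_assoc, mul_left_comm _ (Fintype.card (K × K) : ℂ)⁻¹,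
    ← Finset.mul_sum]
  rw [this]

theorem star_twistedMul (a b : G → ℂ) :
    star (twistedMul ω ι a b) = twistedMul ω ι (star b) (star a) := by
  ext x
  simp only [twistedMul, Pi.star_apply, star_mul', star_sum, star_inv₀, star_natCast,
    hω.doubleBicharacter.star]
  rw [Finset.sum_comm]
  simp only [mul_comm]

/-- Summation over G is translation invariant, so the summand depends on h and k only through the
phase and h - k; `sum_sum_sub` then leaves the term h = k. -/
theorem sum_twistedMul [Fintype G] (a b : G → ℂ) :
    ∑ x, twistedMul ω ι a b x = ∑ x, a x * b x := by
  simp only [twistedMul]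
  rw [← Finset.mul_sum, Finset.sum_comm]
  have : ∀ h k : K × K, ∑ x, doubleBicharacter ω h k *
      (a (twoSidedTranslate ι h x) * b (twoSidedTranslate ι k x)) =
      doubleBicharacter ω h k * ∑ x, a (twoSidedTranslate ι (h - k) x) * b x := by
    intro h k
    rw [Finset.mul_sum, ← Equiv.sum_comp (twoSidedTranslateEquiv ι (-k))]
    refine Finset.sum_congr rfl fun x _ => ?_
    simp only [twoSidedTranslateEquiv, Equiv.coe_fn_mk, ← twoSidedTranslate_add,
      ← sub_eq_add_neg, sub_self, twoSidedTranslate_zero]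
  rw [Finset.sum_congr rfl fun h _ => Finset.sum_comm]
  simp only [this]
  rw [hω.doubleBicharacter.sum_sum_sub fun h => ∑ x, a (twoSidedTranslate ι h x) * b x]
  simp only [twoSidedTranslate_zero]
  rw [inv_mul_cancel_left₀ (Nat.cast_ne_zero.2 Fintype.card_ne_zero)]

/-- Over the subgroup through which one twists, the product is the pointwise one. -/
theorem twistedMul_apply_range (a b : G → ℂ) (t : Multiplicative K) :
    twistedMul ω ι a b (ι t) = a (ι t) * b (ι t) := by
  have := hω.sum_collapse (fun h => a (ι (t * Multiplicative.ofAdd h)))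
    (fun h => b (ι (t * Multiplicative.ofAdd h)))
  simp only [ofAdd_zero, mul_one] at this
  -- K is abelian, so on the range of ι a translate sees only the difference of its two legs. This
  -- is the form required by `sum_collapse`.
  have key : ∀ h : K × K, twoSidedTranslate ι h (ι t) =
      ι (t * Multiplicative.ofAdd (h.2 - h.1)) := by
    intro h
    rw [twoSidedTranslate, ← map_inv, ← map_mul, ← map_mul, ofAdd_sub, mul_comm _ t, mul_assoc,
      mul_comm _ (Multiplicative.ofAdd h.2), div_eq_mul_inv]
  simp only [twistedMul, key, Fintype.sum_prod_type, doubleBicharacter]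
  rw [Finset.sum_comm, Fintype.card_prod, Nat.cast_mul, ← sq]
  have hc : ((Fintype.card K : ℂ) ^ 2) ≠ 0 := pow_ne_zero _ (Nat.cast_ne_zero.2 Fintype.card_ne_zero)
  rw [inv_mul_eq_iff_eq_mul₀ hc, ← this]
  refine Finset.sum_congr rfl fun u _ => Finset.sum_congr rfl fun s _ => ?_
  rw [Finset.sum_comm]
  refine Finset.sum_congr rfl fun u _ => Finset.sum_congr rfl fun s _ => ?_
  ring

/-- The left legs enter only as the difference h.1 - k.1 between x⁻¹ and x. Summing them removes
that factor, x cancels, and the right legs then collapse in the same way. -/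
theorem twistedMul_antipode_sum (f : G → ℂ) (x : G) :
    ∑ h : K × K, ∑ k : K × K, doubleBicharacter ω h k *
      f ((twoSidedTranslate ι h x)⁻¹ * twoSidedTranslate ι k x) =
    Fintype.card (K × K) * f 1 := by
  have key : ∀ h k : K × K, (twoSidedTranslate ι h x)⁻¹ * twoSidedTranslate ι k x =
      (ι (Multiplicative.ofAdd h.2))⁻¹ * x⁻¹ * ι (Multiplicative.ofAdd (h.1 - k.1)) * x *
        ι (Multiplicative.ofAdd k.2) := by
    intro h k
    simp only [twoSidedTranslate, ofAdd_sub, div_eq_mul_inv, map_mul, map_inv]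
    group
  simp only [key, Fintype.sum_prod_type, doubleBicharacter]
  rw [Finset.sum_comm]
  have hs : ∀ u : K, ∑ s, ∑ t, ∑ v, ω s t * ω v u * f ((ι (Multiplicative.ofAdd u))⁻¹ * x⁻¹ *
      ι (Multiplicative.ofAdd (s - t)) * x * ι (Multiplicative.ofAdd v)) =
      Fintype.card K * ∑ v, ω v u * f ((ι (Multiplicative.ofAdd u))⁻¹ * x⁻¹ *
      ι (Multiplicative.ofAdd 0) * x * ι (Multiplicative.ofAdd v)) := by
    intro u
    rw [← hω.sum_sum_sub fun w => ∑ v, ω v u * f ((ι (Multiplicative.ofAdd u))⁻¹ * x⁻¹ *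
      ι (Multiplicative.ofAdd w) * x * ι (Multiplicative.ofAdd v))]
    simp only [Finset.mul_sum, mul_assoc]
  simp only [hs]
  have h1 : ∀ u v : K, (ι (Multiplicative.ofAdd u))⁻¹ * x⁻¹ *
      ι (Multiplicative.ofAdd 0) * x * ι (Multiplicative.ofAdd v) =
      ι (Multiplicative.ofAdd (v - u)) := by
    intro u v
    rw [sub_eq_neg_add]
    simp [mul_assoc]
  simp only [h1]
  rw [← Finset.mul_sum, Finset.sum_comm]
  rw [hω.sum_sum_sub fun w => f (ι (Multiplicative.ofAdd w))]
  simp [mul_assoc]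

/-- Inversion exchanges left and right legs. This transposes the doubled bicharacter, which renaming
h and k undoes. -/
theorem twistedMul_antipode_sum' (f : G → ℂ) (x : G) :
    ∑ h : K × K, ∑ k : K × K, doubleBicharacter ω h k *
      f (twoSidedTranslate ι h x * (twoSidedTranslate ι k x)⁻¹) =
    Fintype.card (K × K) * f 1 := by
  have h := twistedMul_antipode_sum hω (fun y => f y⁻¹) x⁻¹ (ι := ι)
  rw [inv_one] at h
  rw [← h, Finset.sum_comm, ← Equiv.sum_comp (Equiv.prodComm K K)]
  refine Finset.sum_congr rfl fun h _ => ?_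
  rw [← Equiv.sum_comp (Equiv.prodComm K K)]
  refine Finset.sum_congr rfl fun k _ => ?_
  simp only [Equiv.coe_prodComm, twoSidedTranslate_inv, Prod.swap_swap, mul_inv_rev, inv_inv,
    doubleBicharacter, Prod.fst_swap, Prod.snd_swap]
  rw [mul_comm (ω k.2 h.2)]

/-- The core of the multiplicativity of the coproduct. Between x and y stand only differences of a
right leg on x and a left leg on y, with inverse phases, so `sum_collapse` deletes them; the outer
legs form the twist at x * y. -/
theorem twistedMul_comul_sum (a b : G → ℂ) (x y : G) :
    ∑ h : K × K, ∑ k : K × K, ∑ h' : K × K, ∑ k' : K × K,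
      doubleBicharacter ω h k * doubleBicharacter ω h' k' *
      (a (twoSidedTranslate ι h x * twoSidedTranslate ι h' y) *
        b (twoSidedTranslate ι k x * twoSidedTranslate ι k' y)) =
    Fintype.card (K × K) * ∑ h : K × K, ∑ k : K × K, doubleBicharacter ω h k *
      (a (twoSidedTranslate ι h (x * y)) * b (twoSidedTranslate ι k (x * y))) := by
  have key : ∀ h h' : K × K, twoSidedTranslate ι h x * twoSidedTranslate ι h' y =
      (ι (Multiplicative.ofAdd h.1))⁻¹ * x * ι (Multiplicative.ofAdd (h.2 - h'.1)) * y *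
        ι (Multiplicative.ofAdd h'.2) := by
    intro h h'
    simp only [twoSidedTranslate, ofAdd_sub, div_eq_mul_inv, map_mul, map_inv]
    group
  have hsum : ∀ s t u' v' : K, ∑ u, ∑ s', ∑ v, ∑ t', ω v u * ω s' t' *
      (a ((ι (Multiplicative.ofAdd s))⁻¹ * x * ι (Multiplicative.ofAdd (u - s')) * y *
        ι (Multiplicative.ofAdd u')) *
      b ((ι (Multiplicative.ofAdd t))⁻¹ * x * ι (Multiplicative.ofAdd (v - t')) * y *
        ι (Multiplicative.ofAdd v'))) =
      (Fintype.card K : ℂ) ^ 2 *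
      (a (twoSidedTranslate ι (s, u') (x * y)) * b (twoSidedTranslate ι (t, v') (x * y))) := by
    intro s t u' v'
    rw [hω.sum_collapse (fun w => a ((ι (Multiplicative.ofAdd s))⁻¹ * x *
      ι (Multiplicative.ofAdd w) * y * ι (Multiplicative.ofAdd u'))) (fun w =>
      b ((ι (Multiplicative.ofAdd t))⁻¹ * x * ι (Multiplicative.ofAdd w) * y *
        ι (Multiplicative.ofAdd v')))]
    simp [twoSidedTranslate, mul_assoc]
  simp only [key]
  calc _ = ∑ p : (K × K) × (K × K) × (K × K) × (K × K),
        doubleBicharacter ω p.1 p.2.1 * doubleBicharacter ω p.2.2.1 p.2.2.2 *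
        (a ((ι (Multiplicative.ofAdd p.1.1))⁻¹ * x *
          ι (Multiplicative.ofAdd (p.1.2 - p.2.2.1.1)) * y *
          ι (Multiplicative.ofAdd p.2.2.1.2)) *
        b ((ι (Multiplicative.ofAdd p.2.1.1))⁻¹ * x *
          ι (Multiplicative.ofAdd (p.2.1.2 - p.2.2.2.1)) * y *
          ι (Multiplicative.ofAdd p.2.2.2.2))) := by
        simp only [Fintype.sum_prod_type]
    _ = ∑ p : (K × K × K × K) × (K × K × K × K), ω p.1.1 p.1.2.2.1 * ω p.1.2.2.2 p.1.2.1 *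
        (ω p.2.2.2.1 p.2.1 * ω p.2.2.1 p.2.2.2.2 *
        (a ((ι (Multiplicative.ofAdd p.1.1))⁻¹ * x *
          ι (Multiplicative.ofAdd (p.2.1 - p.2.2.1)) * y *
          ι (Multiplicative.ofAdd p.1.2.1)) *
        b ((ι (Multiplicative.ofAdd p.1.2.2.1))⁻¹ * x *
          ι (Multiplicative.ofAdd (p.2.2.2.1 - p.2.2.2.2)) * y *
          ι (Multiplicative.ofAdd p.1.2.2.2)))) :=
        Fintype.sum_equiv
          -- The reindexing puts the four outer legs in the first block and the four inner ones in
          -- the second.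
          { toFun := fun p => ((p.1.1, p.2.2.1.2, p.2.1.1, p.2.2.2.2),
              (p.1.2, p.2.2.1.1, p.2.1.2, p.2.2.2.1))
            invFun := fun p => ((p.1.1, p.2.1), (p.1.2.2.1, p.2.2.2.1), (p.2.2.1, p.1.2.1),
              (p.2.2.2.2, p.1.2.2.2))
            left_inv := fun _ => rfl
            right_inv := fun _ => rfl } _ _
          fun p => by simp only [doubleBicharacter, Equiv.coe_fn_mk]; ring
    _ = ∑ s, ∑ u', ∑ t, ∑ v', ω s t * ω v' u' * ((Fintype.card K : ℂ) ^ 2 *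
        (a (twoSidedTranslate ι (s, u') (x * y)) *
          b (twoSidedTranslate ι (t, v') (x * y)))) := by
        simp only [Fintype.sum_prod_type, ← hsum, Finset.mul_sum]
    _ = _ := by
        simp only [Fintype.sum_prod_type, doubleBicharacter, Finset.mul_sum, Fintype.card_prod,
          Nat.cast_mul, sq]
        refine Finset.sum_congr rfl fun s _ => Finset.sum_congr rfl fun u _ =>
          Finset.sum_congr rfl fun t _ => Finset.sum_congr rfl fun v _ => ?_
        ring

end
end twistedMul

/-! ### Tensors as functions of two variables -/

section slice
variable {G : Type u} {N : Type*} [AddCommGroup N] [Module ℂ N]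

/-- Evaluation of the first tensor factor at a point. -/
noncomputable def sliceAt (N : Type*) [AddCommGroup N] [Module ℂ N] (x : G) :
    (G → ℂ) ⊗[ℂ] N →ₗ[ℂ] N :=
  (TensorProduct.lid ℂ N).toLinearMap ∘ₗ
    (LinearMap.proj (R := ℂ) (φ := fun _ : G => ℂ) x).rTensor N

@[simp] theorem sliceAt_tmul (x : G) (a : G → ℂ) (n : N) :
    sliceAt N x (a ⊗ₜ[ℂ] n) = a x • n := by
  simp [sliceAt]

theorem eq_sum_sliceAt [Fintype G] [DecidableEq G] (t : (G → ℂ) ⊗[ℂ] N) :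
    t = ∑ x, (Pi.single x (1 : ℂ) : G → ℂ) ⊗ₜ[ℂ] sliceAt N x t := by
  induction t with
  | zero => simp
  | add s t hs ht =>
    conv_lhs => rw [hs, ht]
    simp [TensorProduct.tmul_add, Finset.sum_add_distrib]
  | tmul a n =>
    simp only [sliceAt_tmul, ← TensorProduct.smul_tmul]
    rw [← TensorProduct.sum_tmul]
    congr 1
    ext y
    simp [Finset.sum_apply, Pi.single_apply]

theorem tensor_ext_sliceAt [Fintype G] {s t : (G → ℂ) ⊗[ℂ] N}
    (h : ∀ x, sliceAt N x s = sliceAt N x t) : s = t := by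
  classical
  rw [eq_sum_sliceAt s, eq_sum_sliceAt t]
  simp only [h]

theorem tensor_ext_sliceAt_apply [Fintype G] {s t : (G → ℂ) ⊗[ℂ] (G → ℂ)}
    (h : ∀ x y, sliceAt (G → ℂ) x s y = sliceAt (G → ℂ) x t y) : s = t :=
  tensor_ext_sliceAt fun x => funext (h x)

theorem sliceAt_lTensor {M : Type*} [AddCommGroup M] [Module ℂ M] (f : N →ₗ[ℂ] M) (x : G)
    (t : (G → ℂ) ⊗[ℂ] N) : sliceAt M x (f.lTensor _ t) = f (sliceAt N x t) := by
  induction t with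
  | zero => simp
  | add s t hs ht => simp only [map_add, hs, ht]
  | tmul a n => simp

theorem sliceAt_sliceAt_assoc (x y : G) (s : (G → ℂ) ⊗[ℂ] (G → ℂ)) (n : N) :
    sliceAt N y (sliceAt ((G → ℂ) ⊗[ℂ] N) x (TensorProduct.assoc ℂ _ _ _ (s ⊗ₜ[ℂ] n))) =
      sliceAt (G → ℂ) x s y • n := by
  induction s with
  | zero => simp
  | add s t hs ht => simp only [map_add, hs, ht, TensorProduct.add_tmul, Pi.add_apply, add_smul]
  | tmul a b => simp [mul_smul]

theorem sliceAt_comm (x y : G) (t : (G → ℂ) ⊗[ℂ] (G → ℂ)) :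
    sliceAt (G → ℂ) x (TensorProduct.comm ℂ _ _ t) y = sliceAt (G → ℂ) y t x := by
  induction t with
  | zero => simp
  | add s t hs ht => simp only [map_add, hs, ht, Pi.add_apply]
  | tmul a b => simp [mul_comm]

end slice

/-! ### The coalgebra of functions on a finite group -/

section coalgebra
variable {G : Type u} [Group G] [Fintype G] [DecidableEq G]

theorem sliceAt_functionCoproduct (x y : G) (f : G → ℂ) :
    sliceAt (G → ℂ) x (functionCoproduct G f) y = f (x * y) := by
  simp only [functionCoproduct, LinearMap.sum_apply, map_sum, LinearMap.smulRight_apply, map_smul,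
    sliceAt_tmul, LinearMap.proj_apply, Finset.sum_apply, Pi.smul_apply, smul_eq_mul]
  rw [Finset.sum_eq_single x, Finset.sum_eq_single y]
  · simp
  · intro b _ hb; simp [hb.symm]
  · simp
  · intro b _ hb; simp [hb.symm]
  · simp

/-- `C(G)` is a coalgebra. -/
@[reducible] noncomputable def functionCoalgebra (G : Type u) [Group G] [Fintype G] [DecidableEq G] :
    Coalgebra ℂ (G → ℂ) where
  comul := functionCoproduct G
  counit := LinearMap.proj 1
  coassoc := by
    refine LinearMap.ext fun f => ?_
    refine tensor_ext_sliceAt fun x => tensor_ext_sliceAt_apply fun y z => ?_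
    -- Applying the coproduct to the first factor and evaluating at x, y is evaluation at x * y;
    -- coassociativity thus becomes associativity in G.
    have h : ∀ t : (G → ℂ) ⊗[ℂ] (G → ℂ), sliceAt (G → ℂ) y (sliceAt ((G → ℂ) ⊗[ℂ] (G → ℂ)) x
        (TensorProduct.assoc ℂ _ _ _ ((functionCoproduct G).rTensor _ t))) =
        sliceAt (G → ℂ) (x * y) t := by
      intro t
      induction t with
      | zero => simp
      | add s t hs ht => simp only [map_add, hs, ht]
      | tmul a b =>
        rw [LinearMap.rTensor_tmul, sliceAt_sliceAt_assoc, sliceAt_functionCoproduct, sliceAt_tmul]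
    simp only [LinearMap.comp_apply, LinearEquiv.coe_coe, h, sliceAt_lTensor,
      sliceAt_functionCoproduct, mul_assoc]
  rTensor_counit_comp_comul := by
    refine LinearMap.ext fun f => ?_
    apply (TensorProduct.lid ℂ (G → ℂ)).injective
    change sliceAt (G → ℂ) 1 (functionCoproduct G f) = _
    ext y
    simp [sliceAt_functionCoproduct]
  lTensor_counit_comp_comul := by
    refine LinearMap.ext fun f => ?_
    refine tensor_ext_sliceAt fun x => ?_
    simp only [LinearMap.comp_apply, sliceAt_lTensor, LinearMap.proj_apply,
      sliceAt_functionCoproduct]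
    simp

theorem map_restrictToSubgroup_functionCoproduct (T : Subgroup G) [Fintype T] [DecidableEq T]
    (f : G → ℂ) :
    TensorProduct.map (restrictToSubgroup T) (restrictToSubgroup T) (functionCoproduct G f) =
      functionCoproduct T (restrictToSubgroup T f) := by
  refine tensor_ext_sliceAt_apply fun x y => ?_
  rw [sliceAt_functionCoproduct]
  have h : ∀ t : (G → ℂ) ⊗[ℂ] (G → ℂ), sliceAt (T → ℂ) x (TensorProduct.map
      (restrictToSubgroup T) (restrictToSubgroup T) t) y = sliceAt (G → ℂ) (x : G) t y := by
    intro t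
    induction t with
    | zero => simp
    | add s t hs ht => simp only [map_add, hs, ht, Pi.add_apply]
    | tmul a b => simp [restrictToSubgroup]
  rw [h, sliceAt_functionCoproduct]
  simp [restrictToSubgroup]

omit [Fintype G] [DecidableEq G] in
theorem restrictToSubgroup_surjective (T : Subgroup G) :
    Function.Surjective (restrictToSubgroup T) :=
  LinearMap.funLeft_surjective_of_injective ℂ ℂ _ Subtype.val_injective

theorem exists_comm_functionCoproduct_ne {x y : G} (h : x * y ≠ y * x) :
    ∃ a : G → ℂ, TensorProduct.comm ℂ (G → ℂ) (G → ℂ) (functionCoproduct G a) ≠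
      functionCoproduct G a := by
  refine ⟨Pi.single (x * y) 1, fun he => ?_⟩
  have := congrArg (fun t => sliceAt (G → ℂ) x t y) he
  simp [sliceAt_comm, sliceAt_functionCoproduct, h.symm] at this

end coalgebra

/-! ### The twisted algebra and its C*-norm -/

section algebra
variable {G : Type u} [Group G] {K : Type*} [AddCommGroup K] [Fintype K] {ω : K → K → ℂ}

/-- Says that the matrix of left multiplication by a* is the adjoint of that of a. Each entry is
written as a pairing with an indicator function, and associativity moves a* across the invariant
trace. -/
theorem star_twistedMul_single {ι : Multiplicative K →* G} [Fintype G] [DecidableEq G]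
    (hω : IsSymplecticBicharacter ω) (a : G → ℂ) (x y : G) :
    star (twistedMul ω ι a (Pi.single y 1) x) = twistedMul ω ι (star a) (Pi.single x 1) y := by
  have h1 : ∀ (f : G → ℂ) (z : G), f z = ∑ w, f w * (Pi.single z (1 : ℂ) : G → ℂ) w := by
    intro f z; simp [Pi.single_apply]
  have h2 := star_twistedMul hω a (Pi.single y 1) (ι := ι)
  have h3 : star (Pi.single y 1 : G → ℂ) = Pi.single y 1 := by
    ext z; by_cases h : z = y <;> simp [h]
  rw [h3] at h2
  have h4 : star (twistedMul ω ι a (Pi.single y 1) x) =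
      star (twistedMul ω ι a (Pi.single y 1)) x := rfl
  rw [h4, h2, h1 (twistedMul ω ι (Pi.single y 1) (star a)) x,
    h1 (twistedMul ω ι (star a) (Pi.single x 1)) y, ← sum_twistedMul hω (ι := ι), twistedMul_assoc hω,
    sum_twistedMul hω]
  simp only [mul_comm]

/-- The function algebra of `G` with the product twisted by `ω`. -/
def TwistedFunctionAlgebra (_ : IsSymplecticBicharacter ω) (_ : Multiplicative K →* G) : Type u :=
  G → ℂ

namespace TwistedFunctionAlgebra
variable (hω : IsSymplecticBicharacter ω) (ι : Multiplicative K →* G)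

noncomputable instance : AddCommGroup (TwistedFunctionAlgebra hω ι) :=
  inferInstanceAs (AddCommGroup (G → ℂ))

noncomputable instance : Module ℂ (TwistedFunctionAlgebra hω ι) :=
  inferInstanceAs (Module ℂ (G → ℂ))

noncomputable instance : Ring (TwistedFunctionAlgebra hω ι) where
  mul := twistedMul ω ι
  one := (1 : G → ℂ)
  left_distrib := twistedMul_add
  right_distrib := add_twistedMul
  zero_mul a := by
    have := smul_twistedMul (ω := ω) (ι := ι) 0 0 a
    rwa [zero_smul, zero_smul] at this
  mul_zero a := by
    have := twistedMul_smul (ω := ω) (ι := ι) 0 a 0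
    rwa [zero_smul, zero_smul] at this
  mul_assoc := twistedMul_assoc hω
  one_mul := one_twistedMul hω
  mul_one := twistedMul_one hω
  neg_add_cancel := neg_add_cancel
  zsmul := fun n a => n • a
  zsmul_zero' := zero_zsmul
  zsmul_succ' n a := by simp [add_smul]
  zsmul_neg' n a := by simp [add_smul, Int.negSucc_eq]

noncomputable instance : Algebra ℂ (TwistedFunctionAlgebra hω ι) :=
  Algebra.ofModule smul_twistedMul twistedMul_smul

noncomputable instance : StarRing (TwistedFunctionAlgebra hω ι) where
  star := (star : (G → ℂ) → (G → ℂ))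
  star_involutive := fun a : G → ℂ => star_star a
  star_mul := star_twistedMul hω
  star_add := fun a b : G → ℂ => star_add a b

instance : StarModule ℂ (TwistedFunctionAlgebra hω ι) :=
  ⟨fun r (a : G → ℂ) => star_smul r a⟩

variable [Fintype G] [DecidableEq G]

instance : FiniteDimensional ℂ (TwistedFunctionAlgebra hω ι) :=
  inferInstanceAs (FiniteDimensional ℂ (G → ℂ))

/-- The basis of indicator functions. -/
noncomputable def basis : Module.Basis G ℂ (TwistedFunctionAlgebra hω ι) := Pi.basisFun ℂ G

/-- The left regular representation. -/
noncomputable def leftRegular : TwistedFunctionAlgebra hω ι →⋆ₐ[ℂ] Matrix G G ℂ :=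
  { Algebra.leftMulMatrix (basis hω ι) with
    map_star' := fun a => by
      change Algebra.leftMulMatrix (basis hω ι) _ = star (Algebra.leftMulMatrix (basis hω ι) a)
      ext x y
      rw [Matrix.star_apply, Algebra.leftMulMatrix_eq_repr_mul, Algebra.leftMulMatrix_eq_repr_mul]
      have hb : ∀ x, basis hω ι x = (Pi.single x 1 : G → ℂ) := fun x => Pi.basisFun_apply ℂ G x
      rw [hb, hb]
      exact (star_twistedMul_single hω a y x).symm }

theorem leftRegular_injective : Function.Injective (leftRegular hω ι) :=
  Algebra.leftMulMatrix_injective (basis hω ι)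

-- The norm is the operator norm on ℓ²(G) pulled back along the faithful regular representation;
-- completeness is automatic in finite dimension.
open scoped Matrix.Norms.L2Operator in
noncomputable instance : CStarAlgebra (TwistedFunctionAlgebra hω ι) :=
  letI := NormedRing.induced _ _ (leftRegular hω ι) (leftRegular_injective hω ι)
  letI := NormedAlgebra.induced ℂ (TwistedFunctionAlgebra hω ι) (Matrix G G ℂ) (leftRegular hω ι)
  { complete := (FiniteDimensional.complete ℂ (TwistedFunctionAlgebra hω ι)).complete
    norm_mul_self_le := fun a => by
      change ‖leftRegular hω ι a‖ * ‖leftRegular hω ι a‖ ≤ ‖leftRegular hω ι (star a * a)‖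
      rw [map_mul, map_star]
      exact CStarRing.norm_mul_self_le _ }

end TwistedFunctionAlgebra
end algebra

/-! ### The Hopf structure on the twisted algebra -/

namespace TwistedFunctionAlgebra
variable {G : Type u} [Group G] {K : Type*} [AddCommGroup K] [Fintype K] {ω : K → K → ℂ}
variable (hω : IsSymplecticBicharacter ω) (ι : Multiplicative K →* G)

/-- Evaluation at a point. -/
noncomputable def eval (x : G) : TwistedFunctionAlgebra hω ι →ₗ[ℂ] ℂ :=
  LinearMap.proj (R := ℂ) (φ := fun _ : G => ℂ) x

theorem ext_eval {a b : TwistedFunctionAlgebra hω ι} (h : ∀ x, eval hω ι x a = eval hω ι x b) :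
    a = b :=
  funext h

theorem eval_mul (x : G) (a b : TwistedFunctionAlgebra hω ι) :
    eval hω ι x (a * b) = (Fintype.card (K × K) : ℂ)⁻¹ * ∑ h : K × K, ∑ k : K × K,
      doubleBicharacter ω h k *
        (eval hω ι (twoSidedTranslate ι h x) a * eval hω ι (twoSidedTranslate ι k x) b) :=
  rfl

/-- Evaluation of a tensor at a pair of points. -/
noncomputable def evalAt (x y : G) :
    TwistedFunctionAlgebra hω ι ⊗[ℂ] TwistedFunctionAlgebra hω ι →ₗ[ℂ] ℂ :=
  LinearMap.proj (R := ℂ) (φ := fun _ : G => ℂ) y ∘ₗ sliceAt (G → ℂ) x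

theorem evalAt_tmul (x y : G) (a b : TwistedFunctionAlgebra hω ι) :
    evalAt hω ι x y (a ⊗ₜ[ℂ] b) = eval hω ι x a * eval hω ι y b := by
  have h := sliceAt_tmul (N := G → ℂ) x a b
  exact congrFun h y

theorem evalAt_one (x y : G) : evalAt hω ι x y 1 = 1 := by
  rw [Algebra.TensorProduct.one_def, evalAt_tmul]
  exact mul_one 1

theorem evalAt_mul (x y : G)
    (s t : TwistedFunctionAlgebra hω ι ⊗[ℂ] TwistedFunctionAlgebra hω ι) :
    evalAt hω ι x y (s * t) = ((Fintype.card (K × K) : ℂ)⁻¹) ^ 2 *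
      ∑ h : K × K, ∑ k : K × K, ∑ h' : K × K, ∑ k' : K × K,
        doubleBicharacter ω h k * doubleBicharacter ω h' k' *
        (evalAt hω ι (twoSidedTranslate ι h x) (twoSidedTranslate ι h' y) s *
          evalAt hω ι (twoSidedTranslate ι k x) (twoSidedTranslate ι k' y) t) := by
  induction s with
  | zero => simp
  | add s s' hs hs' =>
    simp only [add_mul, map_add, hs, hs', mul_add, Finset.sum_add_distrib]
  | tmul a b =>
    induction t with
    | zero => simp
    | add s s' hs hs' => simp only [map_add, hs, hs', mul_add, Finset.sum_add_distrib]
    | tmul c d =>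
      simp only [Algebra.TensorProduct.tmul_mul_tmul, evalAt_tmul, eval_mul]
      rw [mul_mul_mul_comm, ← sq]
      congr 1
      simp only [Finset.sum_mul]
      refine Finset.sum_congr rfl fun h _ => Finset.sum_congr rfl fun k _ => ?_
      simp only [Finset.mul_sum]
      refine Finset.sum_congr rfl fun h' _ => Finset.sum_congr rfl fun k' _ => ?_
      ring

theorem evalAt_star (x y : G)
    (t : TwistedFunctionAlgebra hω ι ⊗[ℂ] TwistedFunctionAlgebra hω ι) :
    evalAt hω ι x y (star t) = star (evalAt hω ι x y t) := by
  induction t with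
  | zero => simp
  | add s t hs ht => simp only [map_add, star_add, hs, ht]
  | tmul a b =>
    rw [TensorProduct.star_tmul, evalAt_tmul, evalAt_tmul, star_mul']
    rfl

theorem tensor_ext_evalAt [Fintype G]
    {s t : TwistedFunctionAlgebra hω ι ⊗[ℂ] TwistedFunctionAlgebra hω ι}
    (h : ∀ x y, evalAt hω ι x y s = evalAt hω ι x y t) : s = t :=
  tensor_ext_sliceAt_apply h

/-- Inversion of the argument. -/
noncomputable def antipode : TwistedFunctionAlgebra hω ι →ₗ[ℂ] TwistedFunctionAlgebra hω ι :=
  LinearMap.funLeft ℂ ℂ (fun x : G => x⁻¹)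

theorem mul'_rTensor_antipode (t : TwistedFunctionAlgebra hω ι ⊗[ℂ] TwistedFunctionAlgebra hω ι)
    (x : G) :
    eval hω ι x (LinearMap.mul' ℂ (TwistedFunctionAlgebra hω ι)
      ((antipode hω ι).rTensor (TwistedFunctionAlgebra hω ι) t)) =
      (Fintype.card (K × K) : ℂ)⁻¹ * ∑ h : K × K, ∑ k : K × K, doubleBicharacter ω h k *
        evalAt hω ι (twoSidedTranslate ι h x)⁻¹ (twoSidedTranslate ι k x) t := by
  induction t with
  | zero => simp
  | add s t hs ht => simp only [map_add, mul_add, Finset.sum_add_distrib, hs, ht]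
  | tmul a b =>
    simp only [evalAt_tmul, LinearMap.rTensor_tmul, LinearMap.mul'_apply, eval_mul]
    rfl

theorem mul'_lTensor_antipode (t : TwistedFunctionAlgebra hω ι ⊗[ℂ] TwistedFunctionAlgebra hω ι)
    (x : G) :
    eval hω ι x (LinearMap.mul' ℂ (TwistedFunctionAlgebra hω ι)
      ((antipode hω ι).lTensor (TwistedFunctionAlgebra hω ι) t)) =
      (Fintype.card (K × K) : ℂ)⁻¹ * ∑ h : K × K, ∑ k : K × K, doubleBicharacter ω h k *
        evalAt hω ι (twoSidedTranslate ι h x) (twoSidedTranslate ι k x)⁻¹ t := by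
  induction t with
  | zero => simp
  | add s t hs ht => simp only [map_add, mul_add, Finset.sum_add_distrib, hs, ht]
  | tmul a b =>
    simp only [evalAt_tmul, LinearMap.lTensor_tmul, LinearMap.mul'_apply, eval_mul]
    rfl

variable [Fintype G] [DecidableEq G]

noncomputable instance : Coalgebra ℂ (TwistedFunctionAlgebra hω ι) := functionCoalgebra G

theorem evalAt_comul (x y : G) (a : TwistedFunctionAlgebra hω ι) :
    evalAt hω ι x y (Coalgebra.comul a) = eval hω ι (x * y) a :=
  sliceAt_functionCoproduct x y a

/-- The counit is evaluation at 1 = ι(1), a point where the twisted product is pointwise. -/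
theorem counit_mul (a b : TwistedFunctionAlgebra hω ι) :
    Coalgebra.counit (R := ℂ) (a * b) = Coalgebra.counit (R := ℂ) a * Coalgebra.counit b := by
  have := twistedMul_apply_range hω a b (ι := ι) 1
  rwa [map_one] at this

theorem comul_mul (a b : TwistedFunctionAlgebra hω ι) :
    Coalgebra.comul (R := ℂ) (a * b) = Coalgebra.comul a * Coalgebra.comul b := by
  refine tensor_ext_evalAt hω ι fun x y => ?_
  simp only [evalAt_mul, evalAt_comul]
  rw [twistedMul_comul_sum hω (fun z => eval hω ι z a) (fun z => eval hω ι z b) x y, sq,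
    mul_assoc, inv_mul_cancel_left₀ (Nat.cast_ne_zero.2 Fintype.card_ne_zero)]
  rfl

theorem comul_one :
    Coalgebra.comul (R := ℂ) (1 : TwistedFunctionAlgebra hω ι) = 1 := by
  refine tensor_ext_evalAt hω ι fun x y => ?_
  rw [evalAt_comul, evalAt_one]
  rfl

noncomputable instance : HopfAlgebra ℂ (TwistedFunctionAlgebra hω ι) :=
  { Bialgebra.mk' ℂ (TwistedFunctionAlgebra hω ι) rfl (counit_mul hω ι _ _) (comul_one hω ι)
      (comul_mul hω ι _ _) with
    antipode := antipode hω ι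
    mul_antipode_rTensor_comul := by
      refine LinearMap.ext fun a => ext_eval hω ι fun x => ?_
      refine (mul'_rTensor_antipode hω ι _ x).trans ?_
      simp only [evalAt_comul]
      rw [twistedMul_antipode_sum hω (fun z => eval hω ι z a) x, inv_mul_cancel_left₀
        (Nat.cast_ne_zero.2 Fintype.card_ne_zero)]
      exact (mul_one _).symm
    mul_antipode_lTensor_comul := by
      refine LinearMap.ext fun a => ext_eval hω ι fun x => ?_
      refine (mul'_lTensor_antipode hω ι _ x).trans ?_
      simp only [evalAt_comul]
      rw [twistedMul_antipode_sum' hω (fun z => eval hω ι z a) x, inv_mul_cancel_left₀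
        (Nat.cast_ne_zero.2 Fintype.card_ne_zero)]
      exact (mul_one _).symm }

noncomputable instance : FiniteQuantumGroup (TwistedFunctionAlgebra hω ι) :=
  { (inferInstance : CStarAlgebra (TwistedFunctionAlgebra hω ι)),
    (inferInstance : HopfAlgebra ℂ (TwistedFunctionAlgebra hω ι)) with
    finiteDimensional := inferInstanceAs (FiniteDimensional ℂ (G → ℂ))
    comul_star := fun a => by
      refine tensor_ext_evalAt hω ι fun x y => ?_
      refine (evalAt_comul hω ι x y (star a)).trans ?_
      refine Eq.trans ?_ (evalAt_star hω ι x y _).symm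
      exact congrArg star (evalAt_comul hω ι x y a).symm
    counit_star := fun _ => rfl
    antipode_star := fun _ => rfl
    antipode_antipode := fun a => ext_eval hω ι fun x =>
      congrArg (fun z => eval hω ι z a) (inv_inv x) }

include hω in
theorem isFiniteQuantumGroup :
    IsFiniteQuantumGroup (twistedMul ω ι) star (functionCoproduct G) := by
  refine ⟨TwistedFunctionAlgebra hω ι, inferInstance, LinearEquiv.refl ℂ (G → ℂ),
    fun _ _ => rfl, fun _ => rfl, fun a => ?_⟩
  have h : TensorProduct.map (LinearEquiv.refl ℂ (G → ℂ)).toLinearMap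
    (LinearEquiv.refl ℂ (G → ℂ)).toLinearMap = LinearMap.id := TensorProduct.map_id
  exact (LinearMap.congr_fun h (functionCoproduct G a)).symm

end TwistedFunctionAlgebra

/-! ### A criterion for noncommutativity -/

section noncomm
variable {G : Type u} [Group G] {K : Type*} [AddCommGroup K] [Fintype K] {ω : K → K → ℂ}
  {ι : Multiplicative K →* G}

theorem IsSymplecticBicharacter.exists_ne_one (hω : IsSymplecticBicharacter ω) {a : K}
    (ha : a ≠ 0) : ∃ b, ω a b ≠ 1 := by
  by_contra! h
  have := hω.sum_right a ha
  simp [h] at this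

theorem IsSymplecticBicharacter.zsmul_right_self (hω : IsSymplecticBicharacter ω) (a : K) (m : ℤ) :
    ω a (m • a) = 1 := by
  induction m with
  | zero => simp [hω.zero_right]
  | succ i ih => rw [add_smul, hω.add_right, ih, one_smul, hω.self, one_mul]
  | pred i ih => rw [sub_smul, sub_eq_add_neg, hω.add_right, ih, one_smul, hω.neg_right, hω.self,
      one_mul]

/-- Multiply the indicators of two points in the orbit of x and evaluate at x. If the phase is
constant over all pairs reaching those points, both orders give the same nonzero count, times phases
that differ. -/
theorem exists_twistedMul_ne (hω : IsSymplecticBicharacter ω) (x : G) (h₀ k₀ : K × K)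
    (hc : ∀ h k, twoSidedTranslate ι h x = twoSidedTranslate ι h₀ x →
      twoSidedTranslate ι k x = twoSidedTranslate ι k₀ x →
      doubleBicharacter ω h k = doubleBicharacter ω h₀ k₀)
    (hne : doubleBicharacter ω h₀ k₀ ≠ doubleBicharacter ω k₀ h₀) :
    ∃ a b : G → ℂ, twistedMul ω ι a b ≠ twistedMul ω ι b a := by
  classical
  set a : G → ℂ := Pi.single (twoSidedTranslate ι h₀ x) 1 with ha
  set b : G → ℂ := Pi.single (twoSidedTranslate ι k₀ x) 1 with hb
  refine ⟨a, b, fun heq => hne ?_⟩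
  have hN : ∀ h₁ : K × K, ∑ h, (Pi.single (twoSidedTranslate ι h₁ x) 1 : G → ℂ)
      (twoSidedTranslate ι h x) ≠ 0 := by
    intro h₁
    simp only [Pi.single_apply, Finset.sum_boole]
    exact Nat.cast_ne_zero.2 (Finset.card_ne_zero.2 ⟨h₁, by simp⟩)
  have h1 : ∑ h, ∑ k, doubleBicharacter ω h k *
      (a (twoSidedTranslate ι h x) * b (twoSidedTranslate ι k x)) =
      doubleBicharacter ω h₀ k₀ * ((∑ h, a (twoSidedTranslate ι h x)) *
        ∑ k, b (twoSidedTranslate ι k x)) := by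
    rw [Finset.sum_mul_sum, Finset.mul_sum]
    refine Finset.sum_congr rfl fun h _ => ?_
    rw [Finset.mul_sum]
    refine Finset.sum_congr rfl fun k _ => ?_
    by_cases e1 : twoSidedTranslate ι h x = twoSidedTranslate ι h₀ x
    · by_cases e2 : twoSidedTranslate ι k x = twoSidedTranslate ι k₀ x
      · rw [hc h k e1 e2]
      · simp [hb, e2]
    · simp [ha, e1]
  have h2 : ∑ h, ∑ k, doubleBicharacter ω h k *
      (b (twoSidedTranslate ι h x) * a (twoSidedTranslate ι k x)) =
      doubleBicharacter ω k₀ h₀ * ((∑ h, a (twoSidedTranslate ι h x)) *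
        ∑ k, b (twoSidedTranslate ι k x)) := by
    rw [Finset.sum_comm, Finset.sum_mul_sum, Finset.mul_sum]
    refine Finset.sum_congr rfl fun h _ => ?_
    rw [Finset.mul_sum]
    refine Finset.sum_congr rfl fun k _ => ?_
    by_cases e1 : twoSidedTranslate ι h x = twoSidedTranslate ι h₀ x
    · by_cases e2 : twoSidedTranslate ι k x = twoSidedTranslate ι k₀ x
      · rw [← hω.doubleBicharacter.star, hc h k e1 e2, hω.doubleBicharacter.star, mul_comm (b _)]
      · simp [hb, e2]
    · simp [ha, e1]
  have h3 := congrFun heq x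
  simp only [twistedMul, h1, h2] at h3
  have h4 := mul_left_cancel₀ (inv_ne_zero (Nat.cast_ne_zero.2 Fintype.card_ne_zero)) h3
  exact mul_right_cancel₀ (mul_ne_zero (hN h₀) (hN k₀)) h4

/-- The twisted product is noncommutative as soon as the image of `ι` meets its conjugate by some
`x` in the (pointwise fixed) image of a cyclic subgroup of order at least three. -/
theorem exists_twistedMul_ne_of_cyclic (hω : IsSymplecticBicharacter ω) (x : G) (z : K)
    (hz : z + z ≠ 0) (hx : ∀ s t : K, ι (Multiplicative.ofAdd s) * x =
      x * ι (Multiplicative.ofAdd t) → s = t ∧ ∃ m : ℤ, s = m • z) :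
    ∃ a b : G → ℂ, twistedMul ω ι a b ≠ twistedMul ω ι b a := by
  obtain ⟨v, hv⟩ := hω.exists_ne_one hz
  have key : ∀ h h₁ : K × K, twoSidedTranslate ι h x = twoSidedTranslate ι h₁ x →
      ∃ m : ℤ, h.1 = h₁.1 + m • z ∧ h.2 = h₁.2 + m • z := by
    intro h h₁ hh
    simp only [twoSidedTranslate] at hh
    obtain ⟨h1, m, hm⟩ := hx (h.1 - h₁.1) (h.2 - h₁.2) (by
      rw [sub_eq_add_neg, sub_eq_add_neg, ofAdd_add, ofAdd_add, ofAdd_neg, ofAdd_neg, map_mul,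
        map_mul, map_inv, map_inv]
      have := congrArg (fun y => ι (Multiplicative.ofAdd h.1) * y *
        (ι (Multiplicative.ofAdd h₁.2))⁻¹) hh
      simpa [mul_assoc] using this.symm)
    exact ⟨m, by rw [← hm]; abel, by rw [← hm, h1]; abel⟩
  -- Changing h and k by stabilizer elements (mz, mz) and (m'z, m'z) keeps the phase ω(z,v): the
  -- choice (v, v) makes the m-terms cancel between the two legs, and ω(z, m'z) = 1.
  refine exists_twistedMul_ne hω x (z, 0) (v, v) (fun h k hh hk => ?_) ?_
  · obtain ⟨m, h1, h2⟩ := key _ _ hh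
    obtain ⟨m', k1, k2⟩ := key _ _ hk
    simp only [doubleBicharacter, h1, h2, k1, k2, zero_add]
    rw [hω.add_left z, mul_assoc, hω.swap_mul, hω.add_right, hω.zsmul_right_self,
      hω.zero_right, mul_one]
  · intro he
    apply hv
    simp only [doubleBicharacter, hω.zero_right, hω.zero_left, mul_one] at he
    rw [hω.add_left]
    have := hω.swap_mul z v
    rwa [← he] at this

end noncomm

/-! ### The standard skew pairing as a symplectic bicharacter -/

section torus
variable {n : ℕ} [NeZero n]

theorem zmodPairing_standardSkew (s t : ZMod n × ZMod n) :
    zmodPairing n (standardSkew n s) t = ZMod.stdAddChar (s.2 * t.1 - s.1 * t.2) := by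
  rw [sub_eq_add_neg, AddChar.map_add_eq_mul, ← neg_mul]
  rfl

theorem isSymplecticBicharacter_zmodPairing :
    IsSymplecticBicharacter fun s t => zmodPairing n (standardSkew n s) t where
  add_left a b c := by
    simp only [zmodPairing_standardSkew, ← AddChar.map_add_eq_mul]
    congr 1
    simp only [Prod.fst_add, Prod.snd_add]; ring
  add_right a b c := by
    simp only [zmodPairing_standardSkew, ← AddChar.map_add_eq_mul]
    congr 1
    simp only [Prod.fst_add, Prod.snd_add]; ring
  self a := by
    rw [zmodPairing_standardSkew, mul_comm, sub_self, AddChar.map_zero_eq_one]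
  star a b := by
    rw [zmodPairing_standardSkew, zmodPairing_standardSkew]
    change (starRingEnd ℂ) _ = _
    rw [← AddChar.map_neg_eq_conj]
    congr 1
    ring
  sum_right a ha := by
    have hs : ∀ c : ZMod n, c ≠ 0 → ∑ i, (ZMod.stdAddChar (c * i) : ℂ) = 0 := fun c hc => by
      have := AddChar.sum_mulShift c (ZMod.isPrimitive_stdAddChar n)
      simpa [hc, mul_comm] using this
    simp only [zmodPairing, Fintype.sum_prod_type, ← Finset.mul_sum, ← Finset.sum_mul]
    by_cases h : a.2 = 0
    · have h1 : a.1 ≠ 0 := fun h1 => ha (Prod.ext h1 h)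
      rw [hs (standardSkew n a).2 (neg_ne_zero.2 h1), mul_zero]
    · rw [hs (standardSkew n a).1 h, zero_mul]

/-- The sign in -S on the second summand becomes a swap of arguments, since ω is skew, and the two
normalizing constants combine to |H|⁻¹. -/
theorem torusDeformedMul_eq {G : Type u} [Group G] (T : Subgroup G)
    (e : Multiplicative (ZMod n × ZMod n) ≃* T) :
    torusDeformedMul T e = twistedMul (fun s t => zmodPairing n (standardSkew n s) t)
      (T.subtype.comp e.toMonoidHom) := by
  ext a b x
  have hc : (Fintype.card ((ZMod n × ZMod n) × (ZMod n × ZMod n)) : ℂ) ≠ 0 :=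
    Nat.cast_ne_zero.2 Fintype.card_ne_zero
  have hp : ∀ h k, sumPairing (zmodPairing n) (skewDouble (standardSkew n) h) k =
      doubleBicharacter (fun s t => zmodPairing n (standardSkew n s) t) h k := by
    intro h k
    have h2 : zmodPairing n (-(standardSkew n h.2)) k.2 = zmodPairing n (standardSkew n k.2) h.2 := by
      rw [← map_neg, zmodPairing_standardSkew, zmodPairing_standardSkew]
      congr 1
      simp only [Prod.fst_neg, Prod.snd_neg]; ring
    exact congrArg (zmodPairing n (standardSkew n h.1) k.1 * ·) h2
  simp only [torusDeformedMul, deformedMul, hp, Pi.smul_apply, Finset.sum_apply, smul_eq_mul,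
    Pi.mul_apply, ← mul_assoc]
  rw [show (Fintype.card ((ZMod n × ZMod n) × (ZMod n × ZMod n)) : ℂ) *
    ((Fintype.card ((ZMod n × ZMod n) × (ZMod n × ZMod n)) : ℂ) ^ 2)⁻¹ =
    (Fintype.card ((ZMod n × ZMod n) × (ZMod n × ZMod n)) : ℂ)⁻¹ by field_simp]
  simp only [twistedMul, ← mul_assoc]
  rfl

end torus

/-! ### The diagonal torus and unipotent matrices in GL(2, F) -/

section GL2
variable (F : Type u) [Field F]

theorem diagonalTorus_hom_injective : Function.Injective
    (Units.map ((Matrix.diagonalRingHom (Fin 2) F : (Fin 2 → F) →+* Matrix (Fin 2) (Fin 2) F) :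
      (Fin 2 → F) →* Matrix (Fin 2) (Fin 2) F)) :=
  Units.map_injective Matrix.diagonal_injective

/-- The diagonal torus is a product of two copies of the multiplicative group. -/
noncomputable def diagonalTorusEquiv : Fˣ × Fˣ ≃* diagonalTorus F :=
  (((MulEquiv.piUnits (M := fun _ : Fin 2 => F)).trans
    { piFinTwoEquiv (fun _ => Fˣ) with map_mul' := fun _ _ => rfl }).symm).trans
    (MonoidHom.ofInjective (diagonalTorus_hom_injective F))

theorem diagonalTorusEquiv_coe (p : Fˣ × Fˣ) :
    (((diagonalTorusEquiv F p : diagonalTorus F) : GL (Fin 2) F) : Matrix (Fin 2) (Fin 2) F) =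
      !![(p.1 : F), 0; 0, (p.2 : F)] := by
  have : (((diagonalTorusEquiv F p : diagonalTorus F) : GL (Fin 2) F) :
    Matrix (Fin 2) (Fin 2) F) = Matrix.diagonal ![(p.1 : F), (p.2 : F)] := by
    change Matrix.diagonal _ = _
    congr 1
    ext i
    fin_cases i <;> rfl
  rw [this]
  ext i j
  fin_cases i <;> fin_cases j <;> rfl

theorem nonempty_mulEquiv_diagonalTorus [Fintype F] :
    Nonempty (Multiplicative (ZMod (Fintype.card F - 1) × ZMod (Fintype.card F - 1)) ≃*
      diagonalTorus F) := by
  classical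
  obtain ⟨g, hg⟩ := IsCyclic.exists_generator (α := Fˣ)
  have hn : Nat.card Fˣ = Fintype.card F - 1 := by
    rw [Nat.card_eq_fintype_card, Fintype.card_units]
  have e := zmodMulEquivOfGenerator hg hn
  exact ⟨(MulEquiv.prodMultiplicative _ _).trans ((e.prodCongr e).trans (diagonalTorusEquiv F))⟩

/-- The unipotent matrix `(1 1; 0 1)`. -/
noncomputable def upperUnipotent : GL (Fin 2) F :=
  Matrix.GeneralLinearGroup.mkOfDetNeZero !![1, 1; 0, 1] (by simp)

/-- The unipotent matrix `(1 0; 1 1)`. -/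
noncomputable def lowerUnipotent : GL (Fin 2) F :=
  Matrix.GeneralLinearGroup.mkOfDetNeZero !![1, 0; 1, 1] (by simp)

theorem upperUnipotent_mul_lowerUnipotent_ne :
    upperUnipotent F * lowerUnipotent F ≠ lowerUnipotent F * upperUnipotent F := by
  intro h
  have := congrArg (fun M : GL (Fin 2) F => (M : Matrix (Fin 2) (Fin 2) F) 0 0) h
  simp [upperUnipotent, lowerUnipotent, Matrix.GeneralLinearGroup.mkOfDetNeZero,
    Matrix.mul_apply, Fin.sum_univ_two] at this

/-- Computes the stabilizer of the unipotent: the diagonal entries give p = r, and the upper right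
entry gives p.1 = r.2, so p is scalar. -/
theorem diagonalTorusEquiv_mul_upperUnipotent {p r : Fˣ × Fˣ}
    (h : (diagonalTorusEquiv F p : GL (Fin 2) F) * upperUnipotent F =
      upperUnipotent F * (diagonalTorusEquiv F r : GL (Fin 2) F)) :
    p = r ∧ p.1 = p.2 := by
  have hM := congrArg (fun M : GL (Fin 2) F => (M : Matrix (Fin 2) (Fin 2) F)) h
  have hu : (upperUnipotent F : Matrix (Fin 2) (Fin 2) F) = !![1, 1; 0, 1] := rfl
  simp only [Units.val_mul, diagonalTorusEquiv_coe, hu] at hM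
  have h00 := congrFun (congrFun hM 0) 0
  have h01 := congrFun (congrFun hM 0) 1
  have h11 := congrFun (congrFun hM 1) 1
  simp [Matrix.mul_apply, Fin.sum_univ_two] at h00 h01 h11
  exact ⟨Prod.ext (Units.ext h00) (Units.ext h11), Units.ext (h01.trans h11.symm)⟩

theorem exists_torusDeformedMul_ne [Fintype F]
    (e : Multiplicative (ZMod (Fintype.card F - 1) × ZMod (Fintype.card F - 1)) ≃*
      diagonalTorus F) (h2 : Fintype.card F ≠ 2) (h3 : Fintype.card F ≠ 3) :
    ∃ a b : GL (Fin 2) F → ℂ,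
      torusDeformedMul (diagonalTorus F) e a b ≠ torusDeformedMul (diagonalTorus F) e b a := by
  classical
  obtain ⟨g, hg⟩ := IsCyclic.exists_generator (α := Fˣ)
  have hn : orderOf g = Fintype.card F - 1 := by
    rw [orderOf_eq_card_of_forall_mem_zpowers hg, Nat.card_eq_fintype_card, Fintype.card_units]
  rw [torusDeformedMul_eq]
  have hz : e (Multiplicative.ofAdd (e.symm (diagonalTorusEquiv F (g, g))).toAdd) =
    diagonalTorusEquiv F (g, g) := e.apply_symm_apply _
  -- The element z corresponds to the scalar matrix g, with g a generator of Fˣ, so its multiples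
  -- are exactly the scalar matrices.
  refine exists_twistedMul_ne_of_cyclic isSymplecticBicharacter_zmodPairing (upperUnipotent F)
    (e.symm (diagonalTorusEquiv F (g, g))).toAdd ?_ ?_
  · intro h0
    have h1 : e (Multiplicative.ofAdd ((e.symm (diagonalTorusEquiv F (g, g))).toAdd +
      (e.symm (diagonalTorusEquiv F (g, g))).toAdd)) = 1 := by
      rw [h0, ofAdd_zero, map_one]
    rw [ofAdd_add, map_mul, hz, ← map_mul, ← (diagonalTorusEquiv F).map_one,
      (diagonalTorusEquiv F).injective.eq_iff] at h1
    have h1' : g ^ 2 = 1 := by rw [sq]; exact congrArg Prod.fst h1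
    -- If 2z = 0, then q - 1 divides 2; this is where q = 2 and q = 3 are excluded.
    have := Nat.le_of_dvd two_pos (orderOf_dvd_of_pow_eq_one h1')
    have := Fintype.one_lt_card (α := F)
    omega
  · intro s t hst
    obtain ⟨p, hp⟩ := (diagonalTorusEquiv F).surjective (e (Multiplicative.ofAdd s))
    obtain ⟨r, hr⟩ := (diagonalTorusEquiv F).surjective (e (Multiplicative.ofAdd t))
    obtain ⟨hpr, hpp⟩ := diagonalTorusEquiv_mul_upperUnipotent F (p := p) (r := r) (by
      rw [hp, hr]; exact hst)
    refine ⟨?_, ?_⟩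
    · rw [← hpr, hp] at hr
      exact Multiplicative.ofAdd.injective (e.injective hr)
    · obtain ⟨m, hm⟩ := Subgroup.mem_zpowers_iff.1 (hg p.1)
      refine ⟨m, Multiplicative.ofAdd.injective (e.injective ?_)⟩
      rw [← hp, ofAdd_zsmul, map_zpow, hz, ← map_zpow]
      congr 1
      exact Prod.ext hm.symm (hpp.symm.trans hm.symm)

end GL2

theorem mainTheorem9 (F : Type*) [Field F] [Fintype F] [DecidableEq F]
    [Fintype (diagonalTorus F)] [DecidableEq (diagonalTorus F)] :
    Nonempty (Multiplicative (ZMod (Fintype.card F - 1) × ZMod (Fintype.card F - 1)) ≃*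
      diagonalTorus F) ∧
    ∀ e : Multiplicative (ZMod (Fintype.card F - 1) × ZMod (Fintype.card F - 1)) ≃*
        diagonalTorus F,
      -- `C(GL(2, F))_J` is a finite quantum group
      IsFiniteQuantumGroup (torusDeformedMul (diagonalTorus F) e) star
        (functionCoproduct (GL (Fin 2) F)) ∧
      -- which contains `T` as a subgroup
      (Function.Surjective (restrictToSubgroup (diagonalTorus F)) ∧
        (∀ a b : GL (Fin 2) F → ℂ,
          restrictToSubgroup (diagonalTorus F) (torusDeformedMul (diagonalTorus F) e a b) =
            restrictToSubgroup (diagonalTorus F) a * restrictToSubgroup (diagonalTorus F) b) ∧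
        (∀ a : GL (Fin 2) F → ℂ,
          restrictToSubgroup (diagonalTorus F) (star a) =
            star (restrictToSubgroup (diagonalTorus F) a)) ∧
        (∀ a : GL (Fin 2) F → ℂ,
          TensorProduct.map (restrictToSubgroup (diagonalTorus F))
              (restrictToSubgroup (diagonalTorus F)) (functionCoproduct (GL (Fin 2) F) a) =
            functionCoproduct (diagonalTorus F) (restrictToSubgroup (diagonalTorus F) a))) ∧
      -- it is noncommutative and noncocommutative when `q ≠ 2, 3`
      (Fintype.card F ≠ 2 → Fintype.card F ≠ 3 →
        (∃ a b : GL (Fin 2) F → ℂ,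
          torusDeformedMul (diagonalTorus F) e a b ≠ torusDeformedMul (diagonalTorus F) e b a) ∧
        (∃ a : GL (Fin 2) F → ℂ,
          TensorProduct.comm ℂ (GL (Fin 2) F → ℂ) (GL (Fin 2) F → ℂ)
              (functionCoproduct (GL (Fin 2) F) a) ≠ functionCoproduct (GL (Fin 2) F) a)) := by
  refine ⟨nonempty_mulEquiv_diagonalTorus F, fun e => ⟨?_, ⟨restrictToSubgroup_surjective _,
    fun a b => ?_, fun a => rfl, map_restrictToSubgroup_functionCoproduct _⟩,
    fun h2 h3 => ⟨exists_torusDeformedMul_ne F e h2 h3,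
      exists_comm_functionCoproduct_ne (upperUnipotent_mul_lowerUnipotent_ne F)⟩⟩⟩
  · rw [torusDeformedMul_eq]
    exact TwistedFunctionAlgebra.isFiniteQuantumGroup isSymplecticBicharacter_zmodPairing _
  · rw [torusDeformedMul_eq]
    ext t
    have := twistedMul_apply_range isSymplecticBicharacter_zmodPairing a b
      (ι := (diagonalTorus F).subtype.comp e.toMonoidHom) (e.symm t)
    simpa [restrictToSubgroup] using this
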